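/- Let $E(x)=\frac12\int_{|x|}^{\infty}\frac{e^{-t}}{t}\,dt$ for $x\in\mathbb{R}\setminus\{0\}$ be the normalized exponential integral. Let $c>0$ and let $\lambda,T_M$ be real constants with $\lambda>0$. Let $f\in C^2(\mathbb{R})$ satisfy $0<\lambda\le f(y)\le T_M$ and $$f''(y)-c\,f'(y)-f(y)^4=-\int_{\mathbb{R}}E(y-\eta)\,f(\eta)^4\,d\eta$$ for all $y\in\mathbb{R}$. Then $f$ is constant. -/

import Mathlib

open MeasureTheory

/-- The exponential integral `E₁(x) = ∫_{|x|}^∞ e^{-t}/t dt`. The integral diverges only at the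
single point `x = 0`, where Lean assigns the value `0`; this does not affect any integral
against `E₁`. -/
noncomputable def expInt (x : ℝ) : ℝ :=
  ∫ t in Set.Ioi |x|, Real.exp (-t) / t

/-- The normalized kernel `E = E₁ / 2`, which has total integral `1` over the real line. -/
noncomputable def kernelE (x : ℝ) : ℝ :=
  expInt x / 2

/-- `f` is a classical (`C²`) solution on the whole real line of
`f'' - c f' - f⁴ = - ∫_ℝ E(y - η) f(η)⁴ dη`, subject to the bounds `lam ≤ f ≤ TM`. -/
structure IsWholeLineSolution (c lam TM : ℝ) (f : ℝ → ℝ) : Prop where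
  contDiff : ContDiff ℝ 2 f
  equation : ∀ y : ℝ,
    deriv (deriv f) y - c * deriv f y - f y ^ 4 = -∫ η : ℝ, kernelE (y - η) * f η ^ 4
  lower : ∀ y : ℝ, lam ≤ f y
  upper : ∀ y : ℝ, f y ≤ TM

/-!
Write `g = f⁴`. Since `E` has total mass `1`, the equation reads
`f'' - c f' = ∫ E(y - η) (g(y) - g(η)) dη`, and the proof is an energy estimate for this nonlocal
operator.

Testing it on `[a, b]` against a weight `φ` and symmetrizing over the square `[a, b]²` gives
`½ ∬ E(x - y) (g x - g y) (φ x - φ y)` plus the interaction of `[a, b]` with its complement. The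
latter is at most `sup |φ|` times `crossFlux g a + crossFlux g b`, where `crossFlux g R` integrates
`E(x - y) |g x - g y|` over the pairs `x ≤ R < y`; it is bounded because `E` has a finite first
moment. This is `integral_weight_nonlocal_ge`, used for two kinds of weights:

* `φ = ±1`, where the quadratic term vanishes, so that the flux `f' - c f` changes over `[a, b]`
  only by endpoint terms (`IsWholeLineSolution.abs_flux_sub_le`);
* `φ = f`, where the quadratic term is nonnegative because `f⁴` increases with `f > 0`.

Integrating by parts in the second case leaves `∫ f'²` and the boundary term `c (f(b)² - f(a)²) / 2`,
which the first case controls. The result, `IsWholeLineSolution.integral_deriv_sq_le`, bounds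
`∫_a^b f'²` by `|f'|` and `crossFlux` at the endpoints. These are bounded, so `f' ∈ L²(ℝ)`; as `f''`
is bounded too, `f' → 0` at `±∞`, hence `f⁴` is slowly varying there and `crossFlux → 0` by dominated
convergence. Letting `a → -∞` and `b → ∞` in the same inequality gives `∫ f'² = 0`.
-/

/-! ### The exponential integral kernel -/

lemma expInt_nonneg (x : ℝ) : 0 ≤ expInt x :=
  setIntegral_nonneg measurableSet_Ioi fun _ ht =>
    div_nonneg (Real.exp_pos _).le ((abs_nonneg x).trans (le_of_lt ht))

lemma measurable_expInt : Measurable expInt := by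
  have hm : Measurable fun p : ℝ × ℝ =>
      {q : ℝ × ℝ | |q.1| < q.2}.indicator (fun q => Real.exp (-q.2) / q.2) p :=
    Measurable.indicator (by fun_prop)
      (measurableSet_lt (by fun_prop) measurable_snd)
  have h := (hm.stronglyMeasurable.integral_prod_right' (ν := volume)).measurable
  have he : expInt = fun x => ∫ t : ℝ,
      {q : ℝ × ℝ | |q.1| < q.2}.indicator (fun q => Real.exp (-q.2) / q.2) (x, t) := by
    funext x
    rw [expInt, ← integral_indicator measurableSet_Ioi]
    rfl
  rw [he]
  exact h

/-- Replacing `1 / t` by `1 / x` in the defining integral. -/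
lemma expInt_le {x : ℝ} (hx : 0 < x) : expInt x ≤ Real.exp (-x) / x := by
  have hi : IntegrableOn (fun t : ℝ => Real.exp (-t)) (Set.Ioi x) := integrableOn_exp_neg_Ioi x
  rw [expInt, abs_of_pos hx, ← integral_exp_neg_Ioi x, ← integral_div]
  refine integral_mono_of_nonneg ?_ (hi.div_const x) ?_
  · filter_upwards [ae_restrict_mem measurableSet_Ioi] with t ht
    exact div_nonneg (Real.exp_pos _).le (hx.trans ht).le
  · filter_upwards [ae_restrict_mem measurableSet_Ioi] with t ht
    exact div_le_div_of_nonneg_left (Real.exp_pos _).le hx (le_of_lt ht)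

/-- Integrability and total mass `1` on the half-line, by Fubini for `e^{-t} / t` on the wedge
`0 < x < t`. -/
lemma integrableOn_expInt_Ioi_and_integral :
    IntegrableOn expInt (Set.Ioi 0) ∧ ∫ x in Set.Ioi 0, expInt x = 1 := by
  set F : ℝ × ℝ → ℝ := {q : ℝ × ℝ | q.1 < q.2}.indicator (fun q => Real.exp (-q.2) / q.2) with hF
  have hm : Measurable F :=
    Measurable.indicator (by fun_prop) (measurableSet_lt measurable_fst measurable_snd)
  have hslice : ∀ t : ℝ, (fun x => F (x, t)) =
      (Set.Iio t).indicator fun _ => Real.exp (-t) / t := fun t => rfl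
  have hset : ∀ t : ℝ, Set.Iio t ∩ Set.Ioi 0 = Set.Ioo 0 t := fun t => by
    ext; simp [and_comm]
  have hint : ∀ t ∈ Set.Ioi (0 : ℝ), ∫ x in Set.Ioi 0, F (x, t) = Real.exp (-t) := by
    intro t ht
    have ht' : (0 : ℝ) < t := ht
    rw [hslice t, integral_indicator measurableSet_Iio,
      Measure.restrict_restrict measurableSet_Iio, hset]
    simp [ht'.le]
    field_simp
  have hnn : ∀ t ∈ Set.Ioi (0 : ℝ), ∀ x, 0 ≤ F (x, t) := fun t ht x =>
    Set.indicator_apply_nonneg fun _ => div_nonneg (Real.exp_pos _).le (le_of_lt ht)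
  have hFi : Integrable F ((volume.restrict (Set.Ioi 0)).prod (volume.restrict (Set.Ioi 0))) := by
    rw [integrable_prod_iff' hm.aestronglyMeasurable]
    constructor
    · filter_upwards with t
      rw [hslice t, integrable_indicator_iff measurableSet_Iio, IntegrableOn,
        Measure.restrict_restrict measurableSet_Iio, hset]
      exact integrableOn_const (by simp)
    · refine (integrableOn_exp_neg_Ioi 0).congr ?_
      filter_upwards [ae_restrict_mem measurableSet_Ioi] with t ht
      rw [← hint t ht]
      exact integral_congr_ae (.of_forall fun x => (Real.norm_of_nonneg (hnn t ht x)).symm)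
  have hE : ∀ x ∈ Set.Ioi (0 : ℝ), ∫ t in Set.Ioi 0, F (x, t) = expInt x := by
    intro x hx
    have : (fun t => F (x, t)) = (Set.Ioi x).indicator fun t => Real.exp (-t) / t := rfl
    rw [this, integral_indicator measurableSet_Ioi, Measure.restrict_restrict measurableSet_Ioi,
      Set.inter_eq_left.2 (Set.Ioi_subset_Ioi (le_of_lt hx)), expInt, abs_of_pos hx]
  constructor
  · refine hFi.integral_prod_left.congr ?_
    filter_upwards [ae_restrict_mem measurableSet_Ioi] with x hx using hE x hx
  · rw [← setIntegral_congr_fun measurableSet_Ioi hE,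
      integral_integral_swap (f := fun x t => F (x, t)) hFi,
      setIntegral_congr_fun measurableSet_Ioi hint, integral_exp_neg_Ioi]
    simp

lemma expInt_neg (x : ℝ) : expInt (-x) = expInt x := by simp [expInt]

lemma expInt_abs (x : ℝ) : expInt |x| = expInt x := by simp [expInt]

lemma kernelE_neg (x : ℝ) : kernelE (-x) = kernelE x := by rw [kernelE, expInt_neg, kernelE]

lemma kernelE_nonneg (x : ℝ) : 0 ≤ kernelE x := div_nonneg (expInt_nonneg x) zero_le_two

lemma measurable_kernelE : Measurable kernelE := measurable_expInt.div_const 2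

lemma integrable_kernelE : Integrable kernelE := by
  have h0 := integrableOn_expInt_Ioi_and_integral.1
  have h1 : IntegrableOn expInt (Set.Iio 0) := by
    have := ((Measure.measurePreserving_neg (volume : Measure ℝ)).integrableOn_comp_preimage
      (Homeomorph.neg ℝ).measurableEmbedding).2 h0
    simpa [Function.comp_def, expInt_neg] using this
  have h2 : IntegrableOn expInt (Set.Iic 0) :=
    (integrableOn_Iic_iff_integrableOn_Iio (by simp)).2 h1
  have := h2.union h0
  rw [Set.Iic_union_Ioi, integrableOn_univ] at this
  exact this.div_const 2

lemma integral_kernelE : ∫ x, kernelE x = 1 := by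
  have h : ∫ x, expInt x = 2 := by
    have := integral_comp_abs (f := expInt)
    simp only [expInt_abs, integrableOn_expInt_Ioi_and_integral.2] at this
    linarith
  simp only [kernelE, integral_div, h]
  norm_num

/-- The first moment of the kernel is finite. On the quadrant, `√s √t ≤ s + t` bounds the kernel
by a product of two Gamma integrands. -/
lemma integrable_kernelE_add :
    Integrable (fun p : ℝ × ℝ => kernelE (p.1 + p.2))
      ((volume.restrict (Set.Ioi 0)).prod (volume.restrict (Set.Ioi 0))) := by
  have hG := Real.GammaIntegral_convergent (s := 1 / 2) (by norm_num)
  refine (Integrable.mul_prod hG hG).mono'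
    (measurable_kernelE.comp (measurable_fst.add measurable_snd)).aestronglyMeasurable ?_
  rw [Measure.prod_restrict]
  filter_upwards [ae_restrict_mem (measurableSet_Ioi.prod measurableSet_Ioi)] with p hp
  obtain ⟨hs, ht⟩ : 0 < p.1 ∧ 0 < p.2 := hp
  have key : ∀ x : ℝ, 0 < x → x ^ ((1 : ℝ) / 2 - 1) = (√x)⁻¹ := fun x hx => by
    rw [Real.sqrt_eq_rpow, ← Real.rpow_neg hx.le]; norm_num
  rw [Real.norm_of_nonneg (kernelE_nonneg _), key _ hs, key _ ht, kernelE]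
  have h1 := expInt_le (add_pos hs ht)
  have hs' := Real.sqrt_pos.2 hs
  have ht' := Real.sqrt_pos.2 ht
  have hle : √p.1 * √p.2 ≤ p.1 + p.2 := by
    nlinarith [sq_nonneg (√p.1 - √p.2), Real.sq_sqrt hs.le, Real.sq_sqrt ht.le]
  have h2 : Real.exp (-(p.1 + p.2)) / (p.1 + p.2) ≤
      Real.exp (-(p.1 + p.2)) / (√p.1 * √p.2) :=
    div_le_div_of_nonneg_left (Real.exp_pos _).le (by positivity) hle
  have h3 : Real.exp (-p.1) * (√p.1)⁻¹ * (Real.exp (-p.2) * (√p.2)⁻¹) =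
      Real.exp (-(p.1 + p.2)) / (√p.1 * √p.2) := by
    rw [neg_add, Real.exp_add]; field_simp
  rw [h3]
  have := expInt_nonneg (p.1 + p.2)
  linarith

/-! ### Energy estimate for the nonlocal operator -/

/-- The interaction energy across the point `R`: the integral of `E(x - y) |g x - g y|` over the
pairs `x ≤ R < y` separated by `R`. -/
noncomputable def crossFlux (g : ℝ → ℝ) (R : ℝ) : ℝ :=
  ∫ p in Set.Iic R ×ˢ Set.Ioi R, kernelE (p.1 - p.2) * |g p.1 - g p.2|

/-- The change of variables `x = R - s`, `y = R + t`, for functions of `(x, y)` on the pairs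
separated by `R`. -/
lemma integrableOn_cross_iff (F : ℝ × ℝ → ℝ) (R : ℝ) :
    IntegrableOn F (Set.Iic R ×ˢ Set.Ioi R) ↔
      Integrable (fun p : ℝ × ℝ => F (R - p.1, R + p.2))
        ((volume.restrict (Set.Ioi 0)).prod (volume.restrict (Set.Ioi 0))) := by
  have hmp : MeasurePreserving (Prod.map (fun s : ℝ => R - s) (fun t : ℝ => R + t)) :=
    (Measure.measurePreserving_sub_left volume R).prod (measurePreserving_add_left volume R)
  have hme : MeasurableEmbedding (Prod.map (fun s : ℝ => R - s) (fun t : ℝ => R + t)) :=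
    ((MeasurableEquiv.subLeft R).prodCongr (MeasurableEquiv.addLeft R)).measurableEmbedding
  have hpre : Prod.map (fun s : ℝ => R - s) (fun t : ℝ => R + t) ⁻¹' (Set.Iic R ×ˢ Set.Ioi R) =
      Set.Ici 0 ×ˢ Set.Ioi 0 := by ext p; simp
  rw [← hmp.integrableOn_comp_preimage hme, hpre, IntegrableOn, Measure.volume_eq_prod,
    ← Measure.prod_restrict, Measure.restrict_congr_set Ioi_ae_eq_Ici.symm]
  rfl

lemma setIntegral_cross (F : ℝ × ℝ → ℝ) (R : ℝ) :
    ∫ p in Set.Iic R ×ˢ Set.Ioi R, F p =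
      ∫ p, F (R - p.1, R + p.2)
        ∂((volume.restrict (Set.Ioi (0 : ℝ))).prod (volume.restrict (Set.Ioi (0 : ℝ)))) := by
  have hmp : MeasurePreserving (Prod.map (fun s : ℝ => R - s) (fun t : ℝ => R + t)) :=
    (Measure.measurePreserving_sub_left volume R).prod (measurePreserving_add_left volume R)
  have hme : MeasurableEmbedding (Prod.map (fun s : ℝ => R - s) (fun t : ℝ => R + t)) :=
    ((MeasurableEquiv.subLeft R).prodCongr (MeasurableEquiv.addLeft R)).measurableEmbedding
  have hpre : Prod.map (fun s : ℝ => R - s) (fun t : ℝ => R + t) ⁻¹' (Set.Iic R ×ˢ Set.Ioi R) =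
      Set.Ici 0 ×ˢ Set.Ioi 0 := by ext p; simp
  rw [← hmp.setIntegral_preimage_emb hme, hpre, Measure.volume_eq_prod,
    ← Measure.prod_restrict, Measure.restrict_congr_set Ioi_ae_eq_Ici.symm]
  rfl

lemma crossFlux_eq (g : ℝ → ℝ) (R : ℝ) :
    crossFlux g R = ∫ p, kernelE (p.1 + p.2) * |g (R - p.1) - g (R + p.2)|
      ∂((volume.restrict (Set.Ioi (0 : ℝ))).prod (volume.restrict (Set.Ioi (0 : ℝ)))) := by
  rw [crossFlux, setIntegral_cross]
  refine integral_congr_ae (.of_forall fun p => ?_)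
  have : R - p.1 - (R + p.2) = -(p.1 + p.2) := by ring
  simp only [this, kernelE_neg]

lemma abs_sub_le_two_mul {g : ℝ → ℝ} {G : ℝ} (hG : ∀ x, |g x| ≤ G) (x y : ℝ) :
    |g x - g y| ≤ 2 * G := by
  have h1 := abs_le.1 (hG x)
  have h2 := abs_le.1 (hG y)
  exact abs_le.2 ⟨by linarith, by linarith⟩

lemma integrableOn_crossFlux {g : ℝ → ℝ} (hg : Continuous g) {G : ℝ} (hG : ∀ x, |g x| ≤ G)
    (R : ℝ) :
    IntegrableOn (fun p : ℝ × ℝ => kernelE (p.1 - p.2) * |g p.1 - g p.2|)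
      (Set.Iic R ×ˢ Set.Ioi R) := by
  rw [integrableOn_cross_iff]
  refine (integrable_kernelE_add.mul_const (2 * G)).mono' ?_ (.of_forall fun p => ?_)
  · have := measurable_kernelE
    have := hg.measurable
    exact Measurable.aestronglyMeasurable (by fun_prop)
  · have : R - p.1 - (R + p.2) = -(p.1 + p.2) := by ring
    simp only [this, kernelE_neg]
    rw [Real.norm_of_nonneg (mul_nonneg (kernelE_nonneg _) (abs_nonneg _))]
    exact mul_le_mul_of_nonneg_left (abs_sub_le_two_mul hG _ _) (kernelE_nonneg _)

lemma crossFlux_bounded {g : ℝ → ℝ} {G : ℝ} (hG : ∀ x, |g x| ≤ G) :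
    ∃ C, ∀ R, crossFlux g R ≤ C := by
  refine ⟨∫ p, kernelE (p.1 + p.2) * (2 * G)
    ∂((volume.restrict (Set.Ioi (0 : ℝ))).prod (volume.restrict (Set.Ioi (0 : ℝ)))), fun R => ?_⟩
  rw [crossFlux_eq]
  refine integral_mono_of_nonneg (.of_forall fun p => ?_)
    (integrable_kernelE_add.mul_const (2 * G)) (.of_forall fun p => ?_)
  · exact mul_nonneg (kernelE_nonneg _) (abs_nonneg _)
  · exact mul_le_mul_of_nonneg_left (abs_sub_le_two_mul hG _ _) (kernelE_nonneg _)

/-- If `g` is asymptotically slowly varying along `l`, the interaction across `R` vanishes in the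
limit, by dominated convergence. -/
lemma tendsto_crossFlux {g : ℝ → ℝ} (hg : Continuous g) {G : ℝ} (hG : ∀ x, |g x| ≤ G)
    {l : Filter ℝ} [l.IsCountablyGenerated]
    (hl : ∀ s t : ℝ, 0 < s → 0 < t →
      Filter.Tendsto (fun R => g (R - s) - g (R + t)) l (nhds 0)) :
    Filter.Tendsto (crossFlux g) l (nhds 0) := by
  have h := tendsto_integral_filter_of_dominated_convergence (l := l)
    (μ := (volume.restrict (Set.Ioi (0 : ℝ))).prod (volume.restrict (Set.Ioi (0 : ℝ))))
    (F := fun R p => kernelE (p.1 + p.2) * |g (R - p.1) - g (R + p.2)|) (f := fun _ => 0)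
    (fun p => kernelE (p.1 + p.2) * (2 * G)) ?_ ?_ (integrable_kernelE_add.mul_const (2 * G)) ?_
  · simpa [← crossFlux_eq] using h
  · refine .of_forall fun R => ?_
    have := measurable_kernelE
    have := hg.measurable
    exact Measurable.aestronglyMeasurable (by fun_prop)
  · refine .of_forall fun R => .of_forall fun p => ?_
    rw [Real.norm_of_nonneg (mul_nonneg (kernelE_nonneg _) (abs_nonneg _))]
    exact mul_le_mul_of_nonneg_left (abs_sub_le_two_mul hG _ _) (kernelE_nonneg _)
  · rw [Measure.prod_restrict]
    filter_upwards [ae_restrict_mem (measurableSet_Ioi.prod measurableSet_Ioi)] with p hp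
    simpa using ((hl p.1 p.2 hp.1 hp.2).abs).const_mul (kernelE (p.1 + p.2))

lemma integrable_kernelE_strip (a b : ℝ) :
    Integrable (fun p : ℝ × ℝ => kernelE (p.1 - p.2))
      ((volume.restrict (Set.Ioc a b)).prod volume) := by
  have hm : Measurable fun p : ℝ × ℝ => kernelE (p.1 - p.2) :=
    measurable_kernelE.comp (measurable_fst.sub measurable_snd)
  rw [integrable_prod_iff hm.aestronglyMeasurable]
  refine ⟨.of_forall fun x => integrable_kernelE.comp_sub_left x, ?_⟩
  have : ∀ x : ℝ, ∫ y, ‖kernelE (x - y)‖ = ∫ y, ‖kernelE y‖ := fun x =>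
    integral_sub_left_eq_self (fun y => ‖kernelE y‖) volume x
  simp only [this]
  exact integrableOn_const (by simp)

/-- Symmetrizing in `x ↔ y` over a square turns the weighted nonlocal operator into
`½ ∬ E(x - y) (g x - g y) (φ x - φ y)`, which is nonnegative when `φ` is ordered like `g`. -/
lemma setIntegral_square_nonneg {g φ : ℝ → ℝ} {s : Set ℝ}
    (hmono : ∀ x y, 0 ≤ (φ x - φ y) * (g x - g y))
    (hint : IntegrableOn (fun p : ℝ × ℝ => φ p.1 * (kernelE (p.1 - p.2) * (g p.1 - g p.2)))
      (s ×ˢ s)) :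
    0 ≤ ∫ p in s ×ˢ s, φ p.1 * (kernelE (p.1 - p.2) * (g p.1 - g p.2)) := by
  rw [IntegrableOn, Measure.volume_eq_prod, ← Measure.prod_restrict] at hint
  rw [Measure.volume_eq_prod, ← Measure.prod_restrict]
  have hswap := integral_prod_swap (μ := volume.restrict s) (ν := volume.restrict s)
    (fun p : ℝ × ℝ => φ p.1 * (kernelE (p.1 - p.2) * (g p.1 - g p.2)))
  have hsum := integral_add hint hint.swap
  have hnn : 0 ≤ ∫ p : ℝ × ℝ, (φ p.1 * (kernelE (p.1 - p.2) * (g p.1 - g p.2)) +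
      ((fun p : ℝ × ℝ => φ p.1 * (kernelE (p.1 - p.2) * (g p.1 - g p.2))) ∘ Prod.swap) p)
        ∂(volume.restrict s).prod (volume.restrict s) := by
    refine integral_nonneg fun p => ?_
    have h1 : kernelE (p.2 - p.1) = kernelE (p.1 - p.2) := by rw [← kernelE_neg, neg_sub]
    have h2 := mul_nonneg (kernelE_nonneg (p.1 - p.2)) (hmono p.1 p.2)
    simp only [Function.comp, Prod.fst_swap, Prod.snd_swap, h1, Pi.zero_apply]
    linarith
  rw [hsum] at hnn
  simp only [Function.comp_def] at hnn hswap
  rw [hswap] at hnn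
  linarith

/-- Testing `g - E * g` against a weight `φ` ordered like `g`: the contribution of the square
`(a, b]²` is nonnegative, so only the interactions across the endpoints can be negative. -/
lemma integral_weight_nonlocal_ge {g φ : ℝ → ℝ} (hg : Continuous g) (hφ : Continuous φ)
    {G P : ℝ} (hG : ∀ x, |g x| ≤ G) (hP : ∀ x, |φ x| ≤ P)
    (hmono : ∀ x y, 0 ≤ (φ x - φ y) * (g x - g y)) {a b : ℝ} (hab : a ≤ b) :
    -(P * (crossFlux g a + crossFlux g b)) ≤
      ∫ x in a..b, φ x * ∫ y, kernelE (x - y) * (g x - g y) := by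
  have hP0 : 0 ≤ P := (abs_nonneg _).trans (hP 0)
  set F : ℝ × ℝ → ℝ := fun p => φ p.1 * (kernelE (p.1 - p.2) * (g p.1 - g p.2)) with hF
  have hFm : Measurable F := by
    have := measurable_kernelE
    have := hg.measurable
    have := hφ.measurable
    fun_prop
  have hFle : ∀ p, |F p| ≤ P * (kernelE (p.1 - p.2) * |g p.1 - g p.2|) := fun p => by
    rw [hF, abs_mul, abs_mul, abs_of_nonneg (kernelE_nonneg _)]
    exact mul_le_mul_of_nonneg_right (hP _) (mul_nonneg (kernelE_nonneg _) (abs_nonneg _))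
  have hstrip : IntegrableOn F (Set.Ioc a b ×ˢ Set.univ) := by
    rw [IntegrableOn, Measure.volume_eq_prod, ← Measure.prod_restrict, Measure.restrict_univ]
    refine ((integrable_kernelE_strip a b).mul_const (P * (2 * G))).mono'
      hFm.aestronglyMeasurable (.of_forall fun p => (hFle p).trans ?_)
    have := mul_le_mul_of_nonneg_left (abs_sub_le_two_mul hG p.1 p.2)
      (mul_nonneg hP0 (kernelE_nonneg (p.1 - p.2)))
    linarith
  have hlhs : ∫ x in a..b, φ x * ∫ y, kernelE (x - y) * (g x - g y) =
      ∫ p in Set.Ioc a b ×ˢ Set.univ, F p := by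
    rw [Measure.volume_eq_prod, setIntegral_prod _ hstrip, intervalIntegral.integral_of_le hab]
    simp only [hF, Measure.restrict_univ, integral_const_mul]
  have hsub : ∀ t : Set ℝ, IntegrableOn F (Set.Ioc a b ×ˢ t) := fun t =>
    hstrip.mono_set (Set.prod_mono_right (Set.subset_univ t))
  have hsplit : ∫ p in Set.Ioc a b ×ˢ Set.univ, F p =
      (∫ p in Set.Ioc a b ×ˢ Set.Iic a, F p) + (∫ p in Set.Ioc a b ×ˢ Set.Ioc a b, F p) +
        ∫ p in Set.Ioc a b ×ˢ Set.Ioi b, F p := by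
    rw [← Set.Iic_union_Ioi (a := b), Set.prod_union, setIntegral_union _
      (measurableSet_Ioc.prod measurableSet_Ioi) (hsub _) (hsub _),
      ← Set.Iic_union_Ioc_eq_Iic hab, Set.prod_union, setIntegral_union _
      (measurableSet_Ioc.prod measurableSet_Ioc) (hsub _) (hsub _)]
    · exact Set.Disjoint.set_prod_right (Set.Iic_disjoint_Ioc le_rfl) _ _
    · exact Set.Disjoint.set_prod_right (Set.Iic_disjoint_Ioi le_rfl) _ _
  have hsq : 0 ≤ ∫ p in Set.Ioc a b ×ˢ Set.Ioc a b, F p :=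
    setIntegral_square_nonneg hmono (hsub _)
  have hcross : ∀ R, IntegrableOn (fun p : ℝ × ℝ => P * (kernelE (p.1 - p.2) * |g p.1 - g p.2|))
      (Set.Iic R ×ˢ Set.Ioi R) := fun R => (integrableOn_crossFlux hg hG R).const_mul P
  have hnn : ∀ p : ℝ × ℝ, 0 ≤ P * (kernelE (p.1 - p.2) * |g p.1 - g p.2|) := fun p =>
    mul_nonneg hP0 (mul_nonneg (kernelE_nonneg _) (abs_nonneg _))
  have hright : -(P * crossFlux g b) ≤ ∫ p in Set.Ioc a b ×ˢ Set.Ioi b, F p := by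
    have hs : Set.Ioc a b ×ˢ Set.Ioi b ⊆ Set.Iic b ×ˢ Set.Ioi b :=
      Set.prod_mono_left fun x hx => hx.2
    have h1 := setIntegral_mono_set (hcross b) (.of_forall hnn) hs.eventuallyLE
    have h2 := integral_mono ((hcross b).mono_set hs).neg (hsub (Set.Ioi b))
      fun p => (abs_le.1 (hFle p)).1
    simp only [Pi.neg_apply, integral_neg, integral_const_mul] at h1 h2
    rw [crossFlux]
    linarith
  have hleft : -(P * crossFlux g a) ≤ ∫ p in Set.Ioc a b ×ˢ Set.Iic a, F p := by
    -- The swapped strip lies in `Iic a ×ˢ Ioi a`, and the integrand of `crossFlux` is symmetric.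
    have hs : Set.Iic a ×ˢ Set.Ioc a b ⊆ Set.Iic a ×ˢ Set.Ioi a :=
      Set.prod_mono_right fun x hx => hx.1
    have h1 := setIntegral_mono_set (hcross a) (.of_forall hnn) hs.eventuallyLE
    have hsw := setIntegral_prod_swap (μ := volume) (ν := volume) (Set.Ioc a b) (Set.Iic a) F
    have hi := (hsub (Set.Iic a)).swap
    have h2 := integral_mono ((hcross a).mono_set hs).neg hi fun p => by
      have h3 := (abs_le.1 (hFle p.swap)).1
      have h4 : kernelE (p.2 - p.1) = kernelE (p.1 - p.2) := by rw [← kernelE_neg, neg_sub]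
      simp only [Prod.fst_swap, Prod.snd_swap, h4, abs_sub_comm (g p.2)] at h3
      exact h3
    simp only [Pi.neg_apply, integral_neg, integral_const_mul] at h1 h2
    rw [crossFlux]
    simp only [Measure.volume_eq_prod] at *
    simp only [Function.comp_def] at h2
    linarith
  rw [hlhs, hsplit]
  linarith

/-! ### Solutions on the whole line -/

open Filter in
/-- If `f' → 0` at `±∞`, then so do the increments of `f` over windows of fixed size. -/
lemma tendsto_sub_of_tendsto_deriv {f : ℝ → ℝ} (hf : Differentiable ℝ f) {l : Filter ℝ}
    (hl : l = atTop ∨ l = atBot) (h : Tendsto (deriv f) l (nhds 0)) {s t : ℝ} (hs : 0 < s)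
    (ht : 0 < t) : Tendsto (fun R => f (R - s) - f (R + t)) l (nhds 0) := by
  have hex : ∀ R : ℝ, ∃ ξ ∈ Set.Ioo (R - s) (R + t),
      deriv f ξ = (f (R + t) - f (R - s)) / (R + t - (R - s)) := fun R =>
    exists_deriv_eq_slope f (by linarith) hf.continuous.continuousOn hf.differentiableOn
  choose ξ hξ hslope using hex
  have hξl : Tendsto ξ l l := by
    rcases hl with rfl | rfl
    · exact tendsto_atTop_mono (fun R => (hξ R).1.le)
        (tendsto_atTop_add_const_right _ (-s) tendsto_id)
    · exact tendsto_atBot_mono (fun R => (hξ R).2.le)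
        (tendsto_atBot_add_const_right _ t tendsto_id)
  have h1 := (h.comp hξl).mul_const (-(s + t))
  rw [zero_mul] at h1
  refine h1.congr fun R => ?_
  have : R + t - (R - s) ≠ 0 := by linarith
  simp only [Function.comp, hslope]
  field_simp
  ring

namespace IsWholeLineSolution

variable {c lam TM : ℝ} {f : ℝ → ℝ}

lemma hasDerivAt (hf : IsWholeLineSolution c lam TM f) (x : ℝ) : HasDerivAt f (deriv f x) x :=
  ((hf.contDiff.differentiable (by norm_num)) x).hasDerivAt

lemma contDiff_deriv (hf : IsWholeLineSolution c lam TM f) : ContDiff ℝ 1 (deriv f) :=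
  ((contDiff_succ_iff_deriv (n := 1)).1 hf.contDiff).2.2

lemma hasDerivAt_deriv (hf : IsWholeLineSolution c lam TM f) (x : ℝ) :
    HasDerivAt (deriv f) (deriv (deriv f) x) x :=
  ((hf.contDiff_deriv.differentiable (by norm_num)) x).hasDerivAt

lemma continuous_deriv (hf : IsWholeLineSolution c lam TM f) : Continuous (deriv f) :=
  hf.contDiff_deriv.continuous

lemma continuous_deriv_deriv (hf : IsWholeLineSolution c lam TM f) :
    Continuous (deriv (deriv f)) :=
  hf.contDiff_deriv.continuous_deriv le_rfl

lemma abs_le (hf : IsWholeLineSolution c lam TM f) (hlam : 0 < lam) (x : ℝ) : |f x| ≤ TM := by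
  rw [abs_of_pos (hlam.trans_le (hf.lower x))]
  exact hf.upper x

lemma abs_pow_four_le (hf : IsWholeLineSolution c lam TM f) (hlam : 0 < lam) (x : ℝ) :
    |f x ^ 4| ≤ TM ^ 4 := by
  rw [abs_pow]
  exact pow_le_pow_left₀ (abs_nonneg _) (hf.abs_le hlam x) 4

/-- The equation in the form `f'' - c f' = ∫ E(y - η) (f(y)⁴ - f(η)⁴) dη`, using that `E` has
total mass `1`. -/
lemma nonlocal_eq (hf : IsWholeLineSolution c lam TM f) (hlam : 0 < lam) (y : ℝ) :
    deriv (deriv f) y - c * deriv f y = ∫ η, kernelE (y - η) * (f y ^ 4 - f η ^ 4) := by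
  have hk : Integrable fun η => kernelE (y - η) := integrable_kernelE.comp_sub_left y
  have hkf : Integrable fun η => kernelE (y - η) * f η ^ 4 :=
    hk.mul_bdd (c := TM ^ 4) (hf.contDiff.continuous.pow 4).aestronglyMeasurable
      (.of_forall fun η => hf.abs_pow_four_le hlam η)
  simp only [mul_sub]
  rw [integral_sub (hk.mul_const _) hkf, integral_mul_const,
    integral_sub_left_eq_self (fun η => kernelE η), integral_kernelE]
  linarith [hf.equation y]

lemma abs_deriv_deriv_sub_le (hf : IsWholeLineSolution c lam TM f) (hlam : 0 < lam) (y : ℝ) :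
    |deriv (deriv f) y - c * deriv f y| ≤ 2 * TM ^ 4 := by
  rw [hf.nonlocal_eq hlam, ← Real.norm_eq_abs]
  have hk : Integrable fun η => kernelE (y - η) := integrable_kernelE.comp_sub_left y
  refine (norm_integral_le_of_norm_le (hk.mul_const (2 * TM ^ 4))
    (.of_forall fun η => ?_)).trans_eq ?_
  · rw [norm_mul, Real.norm_of_nonneg (kernelE_nonneg _)]
    exact mul_le_mul_of_nonneg_left
      (abs_sub_le_two_mul (g := fun x => f x ^ 4) (hf.abs_pow_four_le hlam) _ _)
      (kernelE_nonneg _)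
  · rw [integral_mul_const, integral_sub_left_eq_self (fun η => kernelE η), integral_kernelE,
      one_mul]

/-- `f'` is bounded: it is bounded at some point of every unit interval by the mean value theorem,
and `f' - c f` is Lipschitz. -/
lemma exists_abs_deriv_le (hf : IsWholeLineSolution c lam TM f) (hlam : 0 < lam) :
    ∃ M, ∀ x, |deriv f x| ≤ M := by
  refine ⟨2 * TM + |c| * (2 * TM) + 2 * TM ^ 4, fun x => ?_⟩
  have hd : Differentiable ℝ f := hf.contDiff.differentiable (by norm_num)
  obtain ⟨ξ, hξ, hs⟩ := exists_deriv_eq_slope f (lt_add_one x) hd.continuous.continuousOn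
    hd.differentiableOn
  rw [add_sub_cancel_left, div_one] at hs
  have hw : ∀ y, HasDerivAt (fun y => deriv f y - c * f y)
      (deriv (deriv f) y - c * deriv f y) y := fun y =>
    (hf.hasDerivAt_deriv y).sub ((hf.hasDerivAt y).const_mul c)
  have hlip := Convex.norm_image_sub_le_of_norm_hasDerivWithin_le (s := Set.univ) (x := ξ) (y := x)
    (fun y _ => (hw y).hasDerivWithinAt) (fun y _ => hf.abs_deriv_deriv_sub_le hlam y)
    convex_univ (Set.mem_univ _) (Set.mem_univ _)
  simp only [Real.norm_eq_abs] at hlip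
  have hx : |x - ξ| ≤ 1 := _root_.abs_le.2 ⟨by linarith [hξ.2], by linarith [hξ.1]⟩
  have hlip' := hlip.trans (mul_le_of_le_one_right (by positivity) hx)
  have h1 := abs_sub_le_two_mul (hf.abs_le hlam) (x + 1) x
  have h2 := mul_le_mul_of_nonneg_left (abs_sub_le_two_mul (hf.abs_le hlam) x ξ) (abs_nonneg c)
  rw [← abs_mul] at h2
  rw [← hs] at h1
  have h3 : deriv f x = (deriv f x - c * f x - (deriv f ξ - c * f ξ)) + deriv f ξ +
      c * (f x - f ξ) := by ring
  rw [h3]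
  linarith [abs_add_three (deriv f x - c * f x - (deriv f ξ - c * f ξ)) (deriv f ξ)
    (c * (f x - f ξ))]

lemma exists_abs_deriv_deriv_le (hf : IsWholeLineSolution c lam TM f) (hlam : 0 < lam) :
    ∃ M, ∀ x, |deriv (deriv f) x| ≤ M := by
  obtain ⟨M, hM⟩ := hf.exists_abs_deriv_le hlam
  refine ⟨2 * TM ^ 4 + |c| * M, fun x => ?_⟩
  have h := abs_add_le (deriv (deriv f) x - c * deriv f x) (c * deriv f x)
  rw [sub_add_cancel, abs_mul] at h
  linarith [hf.abs_deriv_deriv_sub_le hlam x,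
    mul_le_mul_of_nonneg_left (hM x) (abs_nonneg c)]

/-- Testing the equation against `±1`: the flux `f' - c f` changes over `[a, b]` only by the
interactions across the endpoints. -/
lemma abs_flux_sub_le (hf : IsWholeLineSolution c lam TM f) (hlam : 0 < lam) {a b : ℝ}
    (hab : a ≤ b) :
    |(deriv f b - c * f b) - (deriv f a - c * f a)| ≤
      crossFlux (fun x => f x ^ 4) a + crossFlux (fun x => f x ^ 4) b := by
  have hc := hf.continuous_deriv
  have hc' := hf.continuous_deriv_deriv
  have hint : ∫ x in a..b, (deriv (deriv f) x - c * deriv f x) =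
      (deriv f b - c * f b) - (deriv f a - c * f a) :=
    intervalIntegral.integral_eq_sub_of_hasDerivAt
      (fun x _ => (hf.hasDerivAt_deriv x).sub ((hf.hasDerivAt x).const_mul c))
      (Continuous.intervalIntegrable (by fun_prop) _ _)
  have key : ∀ ε : ℝ, |ε| ≤ 1 →
      -(crossFlux (fun x => f x ^ 4) a + crossFlux (fun x => f x ^ 4) b) ≤
        ε * ((deriv f b - c * f b) - (deriv f a - c * f a)) := by
    intro ε hε
    have h := integral_weight_nonlocal_ge (g := fun x => f x ^ 4) (φ := fun _ => ε)
      (hf.contDiff.continuous.pow 4) continuous_const (hf.abs_pow_four_le hlam)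
      (fun _ => hε) (by simp) hab
    simp only [← hf.nonlocal_eq hlam, intervalIntegral.integral_const_mul, hint] at h
    linarith
  have h1 := key 1 (by simp)
  have h2 := key (-1) (by simp)
  exact _root_.abs_le.2 ⟨by linarith, by linarith⟩

/-- Testing the equation against `f`, which is ordered like `f⁴`: the Dirichlet energy over
`[a, b]` is controlled by the endpoints. The term `c f² / 2` is removed by the flux identity. -/
lemma integral_deriv_sq_le (hf : IsWholeLineSolution c lam TM f) (hlam : 0 < lam) {a b : ℝ}
    (hab : a ≤ b) :
    ∫ x in a..b, deriv f x ^ 2 ≤ 2 * TM * (|deriv f a| + |deriv f b| +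
      (crossFlux (fun x => f x ^ 4) a + crossFlux (fun x => f x ^ 4) b)) := by
  have hc0 := hf.contDiff.continuous
  have hc := hf.continuous_deriv
  have hc' := hf.continuous_deriv_deriv
  have hpos : ∀ x, 0 < f x := fun x => hlam.trans_le (hf.lower x)
  have hint : ∫ x in a..b, (deriv f x ^ 2 + f x * (deriv (deriv f) x - c * deriv f x)) =
      (f b * deriv f b - c / 2 * f b ^ 2) - (f a * deriv f a - c / 2 * f a ^ 2) := by
    refine intervalIntegral.integral_eq_sub_of_hasDerivAt
      (f := fun x => f x * deriv f x - c / 2 * f x ^ 2) (fun x _ => ?_)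
      (Continuous.intervalIntegrable (by fun_prop) _ _)
    have := ((hf.hasDerivAt x).mul (hf.hasDerivAt_deriv x)).sub
      (((hf.hasDerivAt x).pow 2).const_mul (c / 2))
    exact this.congr_deriv (by push_cast; ring)
  rw [intervalIntegral.integral_add (Continuous.intervalIntegrable (by fun_prop) _ _)
    (Continuous.intervalIntegrable (by fun_prop) _ _)] at hint
  have hmono : ∀ x y, 0 ≤ (f x - f y) * (f x ^ 4 - f y ^ 4) := fun x y => by
    have h1 := hpos x
    have h2 := hpos y
    have : (f x - f y) * (f x ^ 4 - f y ^ 4) =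
        (f x - f y) ^ 2 * ((f x + f y) * (f x ^ 2 + f y ^ 2)) := by ring
    rw [this]
    positivity
  have h := integral_weight_nonlocal_ge (g := fun x => f x ^ 4) (hc0.pow 4) hc0
    (hf.abs_pow_four_le hlam) (hf.abs_le hlam) hmono hab
  simp only [← hf.nonlocal_eq hlam] at h
  have hflux := hf.abs_flux_sub_le hlam hab
  set J := crossFlux (fun x => f x ^ 4) a + crossFlux (fun x => f x ^ 4) b
  -- `c (f(b)² - f(a)²) / 2` is the mean of `f(a)` and `f(b)` times `c (f(b) - f(a))`.
  have h1 : f b * deriv f b - c / 2 * f b ^ 2 - (f a * deriv f a - c / 2 * f a ^ 2) =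
      (f a + f b) / 2 * ((deriv f b - c * f b) - (deriv f a - c * f a)) +
        (f b - f a) / 2 * (deriv f a + deriv f b) := by ring
  have hT : 0 ≤ TM := (hpos 0).le.trans (hf.upper 0)
  have h2 : (f a + f b) / 2 * ((deriv f b - c * f b) - (deriv f a - c * f a)) ≤ TM * J := by
    refine (le_abs_self _).trans ?_
    rw [abs_mul, abs_of_pos (by linarith [hpos a, hpos b])]
    exact mul_le_mul (by linarith [hf.upper a, hf.upper b]) hflux (abs_nonneg _) hT
  have h3 : (f b - f a) / 2 * (deriv f a + deriv f b) ≤ TM * (|deriv f a| + |deriv f b|) := by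
    refine (le_abs_self _).trans ?_
    rw [abs_mul]
    refine mul_le_mul ?_ (abs_add_le _ _) (abs_nonneg _) hT
    rw [abs_div, abs_two]
    linarith [abs_sub_le_two_mul (hf.abs_le hlam) b a]
  have h4 : 0 ≤ TM * (|deriv f a| + |deriv f b|) := by positivity
  linarith

lemma integrable_deriv_sq (hf : IsWholeLineSolution c lam TM f) (hlam : 0 < lam) :
    Integrable fun x => deriv f x ^ 2 := by
  obtain ⟨M, hM⟩ := hf.exists_abs_deriv_le hlam
  obtain ⟨C, hC⟩ := crossFlux_bounded (g := fun x => f x ^ 4) (hf.abs_pow_four_le hlam)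
  have hc : Continuous fun x => deriv f x ^ 2 := hf.continuous_deriv.pow 2
  have hT : 0 ≤ TM := (abs_nonneg _).trans (hf.abs_le hlam 0)
  refine integrable_of_intervalIntegral_norm_bounded (l := Filter.atTop) (a := fun R : ℝ => -R)
    (b := id) (2 * TM * (M + M + (C + C))) (fun R => hc.integrableOn_Ioc)
    Filter.tendsto_neg_atTop_atBot Filter.tendsto_id ?_
  filter_upwards [Filter.eventually_ge_atTop 0] with R hR
  simp only [Real.norm_of_nonneg (sq_nonneg _), id]
  refine (hf.integral_deriv_sq_le hlam (neg_le_self hR)).trans ?_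
  exact mul_le_mul_of_nonneg_left
    (add_le_add (add_le_add (hM _) (hM _)) (add_le_add (hC _) (hC _))) (by positivity)

open Filter in
/-- Both `f'³` and its derivative `3 f'² f''` are integrable, hence `f' → 0` at `±∞`. -/
lemma tendsto_deriv (hf : IsWholeLineSolution c lam TM f) (hlam : 0 < lam) :
    Tendsto (deriv f) atTop (nhds 0) ∧ Tendsto (deriv f) atBot (nhds 0) := by
  obtain ⟨M, hM⟩ := hf.exists_abs_deriv_le hlam
  obtain ⟨N, hN⟩ := hf.exists_abs_deriv_deriv_le hlam
  have hi := hf.integrable_deriv_sq hlam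
  have hd : ∀ x, HasDerivAt (fun x => deriv f x ^ 3)
      (3 * (deriv f x ^ 2 * deriv (deriv f) x)) x := fun x =>
    ((hf.hasDerivAt_deriv x).pow 3).congr_deriv (by push_cast; ring)
  have h3 : Integrable fun x => deriv f x ^ 3 := by
    simp only [pow_succ _ 2]
    exact hi.mul_bdd (c := M) hf.continuous_deriv.aestronglyMeasurable (.of_forall hM)
  have h3' : Integrable fun x => 3 * (deriv f x ^ 2 * deriv (deriv f) x) :=
    (hi.mul_bdd (c := N) hf.continuous_deriv_deriv.aestronglyMeasurable (.of_forall hN)).const_mul 3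
  have hroot : ∀ l : Filter ℝ, Tendsto (fun x => deriv f x ^ 3) l (nhds 0) →
      Tendsto (deriv f) l (nhds 0) := by
    intro l h
    rw [Metric.tendsto_nhds] at h ⊢
    intro ε hε
    filter_upwards [h (ε ^ 3) (by positivity)] with x hx
    rw [dist_zero_right, norm_pow] at hx
    rw [dist_zero_right]
    exact lt_of_pow_lt_pow_left₀ 3 hε.le hx
  exact ⟨hroot _ (tendsto_zero_of_hasDerivAt_of_integrableOn_Ioi (a := 0) (fun x _ => hd x)
      h3'.integrableOn h3.integrableOn),
    hroot _ (tendsto_zero_of_hasDerivAt_of_integrableOn_Iic (a := 0) (fun x _ => hd x)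
      h3'.integrableOn h3.integrableOn)⟩

open Filter in
lemma tendsto_crossFlux_pow_four (hf : IsWholeLineSolution c lam TM f) (hlam : 0 < lam)
    {l : Filter ℝ} (hl : l = atTop ∨ l = atBot) :
    Tendsto (crossFlux fun x => f x ^ 4) l (nhds 0) := by
  have : l.IsCountablyGenerated := by rcases hl with rfl | rfl <;> infer_instance
  have hd : Tendsto (deriv f) l (nhds 0) := by
    rcases hl with rfl | rfl
    exacts [(hf.tendsto_deriv hlam).1, (hf.tendsto_deriv hlam).2]
  refine tendsto_crossFlux (hf.contDiff.continuous.pow 4) (hf.abs_pow_four_le hlam)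
    fun s t hs ht => ?_
  have h := tendsto_sub_of_tendsto_deriv (hf.contDiff.differentiable (by norm_num)) hl hd hs ht
  have hT : 0 ≤ TM := (abs_nonneg _).trans (hf.abs_le hlam 0)
  have hle : ∀ x y, |f x ^ 4 - f y ^ 4| ≤ 4 * TM ^ 3 * |f x - f y| := fun x y => by
    have hx := hlam.trans_le (hf.lower x)
    have hy := hlam.trans_le (hf.lower y)
    have hx' := hf.upper x
    have hy' := hf.upper y
    have : f x ^ 4 - f y ^ 4 =
        ((f x + f y) * (f x ^ 2 + f y ^ 2)) * (f x - f y) := by ring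
    rw [this, abs_mul, abs_of_nonneg (by positivity)]
    refine mul_le_mul_of_nonneg_right ?_ (abs_nonneg _)
    calc (f x + f y) * (f x ^ 2 + f y ^ 2) ≤ (TM + TM) * (TM ^ 2 + TM ^ 2) := by gcongr
      _ = 4 * TM ^ 3 := by ring
  refine squeeze_zero_norm (fun R => hle (R - s) (R + t)) ?_
  simpa using h.abs.const_mul (4 * TM ^ 3)

open Filter in
lemma deriv_eq_zero (hf : IsWholeLineSolution c lam TM f) (hlam : 0 < lam) (x : ℝ) :
    deriv f x = 0 := by
  have hi := hf.integrable_deriv_sq hlam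
  obtain ⟨hp, hm⟩ := hf.tendsto_deriv hlam
  have hJp := hf.tendsto_crossFlux_pow_four hlam (Or.inl rfl)
  have hJm := hf.tendsto_crossFlux_pow_four hlam (Or.inr rfl)
  have hneg : Tendsto (fun R : ℝ => -R) atTop atBot := tendsto_neg_atTop_atBot
  have hlhs := intervalIntegral_tendsto_integral hi hneg tendsto_id
  have hrhs := (((hm.comp hneg).abs.add hp.abs).add ((hJm.comp hneg).add hJp)).const_mul (2 * TM)
  simp only [abs_zero, add_zero, mul_zero] at hrhs
  have hle : ∫ x, deriv f x ^ 2 ≤ 0 := by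
    refine le_of_tendsto_of_tendsto hlhs hrhs ?_
    filter_upwards [eventually_ge_atTop 0] with R hR
    exact hf.integral_deriv_sq_le hlam (neg_le_self hR)
  have h0 := (integral_eq_zero_iff_of_nonneg (fun x => sq_nonneg (deriv f x)) hi).1
    (le_antisymm hle (integral_nonneg fun x => sq_nonneg _))
  have h1 := (Continuous.ae_eq_iff_eq volume (hf.continuous_deriv.pow 2) continuous_zero).1 h0
  exact pow_eq_zero_iff two_ne_zero |>.1 (congrFun h1 x)

end IsWholeLineSolution

theorem theorem3p6 (c lam TM : ℝ) (hc : 0 < c) (hlam : 0 < lam) (f : ℝ → ℝ)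
    (hf : IsWholeLineSolution c lam TM f) :
    ∃ A : ℝ, ∀ y : ℝ, f y = A :=
  ⟨f 0, fun y => is_const_of_deriv_eq_zero (hf.contDiff.differentiable (by norm_num))
    (hf.deriv_eq_zero hlam) y 0⟩
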